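/- **Theorem (the Model B puzzle is impossible).** Let $r>0$ and $R_1,R_2\ge r$. A *configuration* of the puzzle consists of round circles $H$ (the hoop), $A$, $B$ in $\mathbb{R}^3$ of radii $r,R_1,R_2$ and a curve (the rope) $\gamma:[0,1]\to\mathbb{R}^3$; the *piece* is $P=\gamma([0,1])\cup A\cup B$. A *motion* is a family of configurations $(H_t,A_t,B_t,\gamma_t)$, $t\in[0,1]$, in which the three circles move rigidly (centre and an orthonormal frame of the plane of each circle depend continuously on $t$), $(t,s)\mapsto\gamma_t(s)$ is continuous, $\gamma_t(0)\in A_t$ and $\gamma_t(1)\in B_t$ for all $t$, and $P_t\cap H_t=\emptyset$ for all $t$. The rope and the two circles $A_t,B_t$ are allowed to cut themselves and each other. A configuration is *initial* if $A$ and $B$ lie strictly on opposite sides of the plane of $H$ and the rope meets this plane only inside the open disk bounded by $H$. The hoop is *removed* in a configuration if $P$ is disjoint from the closed flat disk bounded by $H$ (this holds, for instance, whenever a plane strictly separates $P$ from $H$). Then no motion leads from an initial configuration to a configuration in which the hoop is removed. -/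

import Mathlib

open scoped unitInterval

namespace ModelB

/-- Euclidean three-space. -/
abbrev E3 : Type := EuclideanSpace ℝ (Fin 3)

/-- A position in space of a rigid plane circle: its centre and an orthonormal frame
`e₁, e₂` of directions of its plane (the frame is rigidly carried by the circle). -/
structure Placement where
  center : E3
  e₁ : E3
  e₂ : E3
  norm_e₁ : ‖e₁‖ = 1
  norm_e₂ : ‖e₂‖ = 1
  orthogonal : inner ℝ e₁ e₂ = 0

/-- The point with coordinates `(a, b)` in the plane of the placement. -/
def Placement.point (p : Placement) (a b : ℝ) : E3 :=
  p.center + a • p.e₁ + b • p.e₂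

/-- The round circle of radius `ρ` placed at `p`. -/
def Placement.circle (p : Placement) (ρ : ℝ) : Set E3 :=
  {x | ∃ θ : ℝ, x = p.point (ρ * Real.cos θ) (ρ * Real.sin θ)}

/-- The closed flat disk spanning the circle of radius `ρ` placed at `p`. -/
def Placement.disk (p : Placement) (ρ : ℝ) : Set E3 :=
  {x | ∃ a b : ℝ, a ^ 2 + b ^ 2 ≤ ρ ^ 2 ∧ x = p.point a b}

/-- A position of all the parts: the rigid middle hoop, the two rigid circles, and the rope,
a parametrized curve that may be singular and may have self-intersections. -/
structure Configuration where
  hoop : Placement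
  circleA : Placement
  circleB : Placement
  rope : I → E3

/-- The first piece of the puzzle: the rope together with the circles at its two ends,
of radii `R₁` and `R₂`. -/
def Configuration.piece (c : Configuration) (R₁ R₂ : ℝ) : Set E3 :=
  Set.range c.rope ∪ c.circleA.circle R₁ ∪ c.circleB.circle R₂

/-- An allowed motion of the puzzle during the time interval `[0,1]`, with hoop of radius `r` and
end circles of radii `R₁`, `R₂`. The hoop and the two circles move rigidly and continuously; the
rope undergoes an arbitrary homotopy with its ends on the two circles; rope and circles never touch
the hoop. Nothing else is forbidden: the rope and the circles may cross one another and
themselves. -/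
structure IsMotion (r R₁ R₂ : ℝ) (C : I → Configuration) : Prop where
  continuous_hoop : Continuous (fun t => (C t).hoop.center) ∧
    Continuous (fun t => (C t).hoop.e₁) ∧ Continuous (fun t => (C t).hoop.e₂)
  continuous_circleA : Continuous (fun t => (C t).circleA.center) ∧
    Continuous (fun t => (C t).circleA.e₁) ∧ Continuous (fun t => (C t).circleA.e₂)
  continuous_circleB : Continuous (fun t => (C t).circleB.center) ∧
    Continuous (fun t => (C t).circleB.e₁) ∧ Continuous (fun t => (C t).circleB.e₂)
  continuous_rope : Continuous (fun p : I × I => (C p.1).rope p.2)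
  rope_zero_mem : ∀ t, (C t).rope 0 ∈ (C t).circleA.circle R₁
  rope_one_mem : ∀ t, (C t).rope 1 ∈ (C t).circleB.circle R₂
  avoids_hoop : ∀ t, Disjoint ((C t).piece R₁ R₂) ((C t).hoop.circle r)

/-- The initial situation, with the hoop around the rope and between the two circles: the circles
lie strictly on opposite sides of the plane of the hoop, and the rope meets that plane
only inside the hoop. Here `n` is a normal vector of the plane. -/
def Configuration.IsInitial (c : Configuration) (r R₁ R₂ : ℝ) : Prop :=
  ∃ n : E3, n ≠ 0 ∧ inner ℝ n c.hoop.e₁ = 0 ∧ inner ℝ n c.hoop.e₂ = 0 ∧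
    (∀ x ∈ c.circleA.circle R₁, inner ℝ n (x - c.hoop.center) < 0) ∧
    (∀ x ∈ c.circleB.circle R₂, 0 < inner ℝ n (x - c.hoop.center)) ∧
    (∀ s : I, inner ℝ n (c.rope s - c.hoop.center) = 0 → dist (c.rope s) c.hoop.center < r)

/-- The hoop has been removed: nothing passes through it any more, that is, the rope and the
circles do not meet the flat disk spanning the hoop. This is so in particular
whenever some plane has the hoop strictly on one side and the rope and the circles strictly on the
other. -/
def Configuration.HoopRemoved (c : Configuration) (r R₁ R₂ : ℝ) : Prop :=
  Disjoint (c.piece R₁ R₂) (c.hoop.disk r)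

end ModelB

/-!
Why the hoop cannot be removed.

Let `c` be the centre of the hoop and `n` a normal of its plane. The map
`x ↦ (‖x - c‖² - r²) + i ⟨n, x - c⟩` (`Placement.hoopMap`) sends the complement of the hoop to
`ℂ ∖ {0}` and the complement of its flat disk to the slit plane `ℂ ∖ (-∞, 0]`. A round circle of
radius `ρ` goes to an ellipse (`Placement.hoopMap_point`), whose centre has real part
`‖d‖² + ρ² - r²`, with `d` the vector between the two centres. This is nonnegative for `ρ ≥ r`.

During a motion the two ellipses avoid `0`, and initially they lie in opposite open half-planes.
Hence the filled ellipses never contain `0` (`filled_ellipse_ne_zero`). In particular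
their centres are never `0`, so they stay in the slit plane, and the image of the rope can be
extended in `ℂ ∖ {0}` by straight segments to a path from one centre to the other. This path varies
continuously and its ends have a continuous principal argument, so the variation of the
argument along the path minus the difference of the principal arguments at the ends is a constant
of the motion. It is `-2π` initially, because the rope passes through the disk and
nowhere else through the plane of the hoop. Once the hoop is removed the ellipses and the rope lie
in the slit plane, hence so do the filled ellipses (`filled_ellipse_mem_slitPlane`), and the constant
is `0`, a contradiction (`exists_notMem_slitPlane_of_homotopy`).
-/

namespace ModelB

/-! ### Turning of paths in the punctured plane -/

/-- A continuous function on a preconnected space whose exponential is constant is constant. -/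
theorem eq_of_exp_comp_const {Z : Type*} [TopologicalSpace Z] [PreconnectedSpace Z] {f : Z → ℂ}
    (hf : Continuous f) (c : ℂ) (hc : ∀ z, Complex.exp (f z) = c) (z z' : Z) : f z = f z' :=
  Complex.isCoveringMap_exp.const_of_comp hf (fun a a' => by simp [hc]) z z'

/-- Turning number obstruction. In a homotopy of paths in `ℂ ∖ {0}` with both ends confined to the
slit plane, the total variation of the argument minus the difference of the principal arguments
at the ends is a constant multiple of `2π`. It is `-2π` at `x₀`, where the path crosses the
negative real axis from the lower to the upper half-plane and avoids the positive one, whereas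
it is `0` for a path contained in the slit plane. -/
theorem exists_notMem_slitPlane_of_homotopy {X Y : Type*} [TopologicalSpace X] [TopologicalSpace Y]
    [SimplyConnectedSpace (X × Y)] [LocallyPathConnectedSpace (X × Y)]
    [PreconnectedSpace X] [PreconnectedSpace Y]
    (Γ : X × Y → ℂ) (hΓ : Continuous Γ) (hne : ∀ q, Γ q ≠ 0) (x₀ x₁ : X) (y₀ y₁ : Y)
    (h₀ : ∀ x, Γ (x, y₀) ∈ Complex.slitPlane) (h₁ : ∀ x, Γ (x, y₁) ∈ Complex.slitPlane)
    (hstart : ∀ y, -Γ (x₀, y) ∈ Complex.slitPlane)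
    (him₀ : (Γ (x₀, y₀)).im < 0) (him₁ : 0 < (Γ (x₀, y₁)).im) :
    ∃ y, Γ (x₁, y) ∉ Complex.slitPlane := by
  by_contra! hend
  obtain ⟨G, ⟨-, hG⟩, -⟩ := Complex.isCoveringMapOn_exp.existsUnique_continuousMap_lifts
    (⟨Γ, hΓ⟩ : C(X × Y, ℂ)) (a₀ := (x₀, y₀)) (e₀ := Complex.log (Γ (x₀, y₀)))
    (Complex.exp_log (hne _)) (fun a => by simpa using hne a)
  have hG' (q : X × Y) : Complex.exp (G q) = Γ q := congrFun hG q
  have hG1 (q : X × Y) : Complex.exp (G q - Complex.log (Γ q)) = 1 := by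
    rw [Complex.exp_sub, hG', Complex.exp_log (hne _), div_self (hne _)]
  have hL (y : Y) (hy : ∀ x, Γ (x, y) ∈ Complex.slitPlane) :
      G (x₀, y) - Complex.log (Γ (x₀, y)) = G (x₁, y) - Complex.log (Γ (x₁, y)) :=
    eq_of_exp_comp_const (f := fun x => G (x, y) - Complex.log (Γ (x, y)))
      ((by fun_prop : Continuous fun x => G (x, y)).sub
        ((by fun_prop : Continuous fun x => Γ (x, y)).clog hy)) 1
      (fun _ => hG1 _) _ _
  have hR : G (x₁, y₀) - Complex.log (Γ (x₁, y₀)) = G (x₁, y₁) - Complex.log (Γ (x₁, y₁)) :=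
    eq_of_exp_comp_const (f := fun y => G (x₁, y) - Complex.log (Γ (x₁, y)))
      ((by fun_prop : Continuous fun y => G (x₁, y)).sub
        ((by fun_prop : Continuous fun y => Γ (x₁, y)).clog hend)) 1
      (fun _ => hG1 _) _ _
  have hS : G (x₀, y₀) - Complex.log (-Γ (x₀, y₀)) = G (x₀, y₁) - Complex.log (-Γ (x₀, y₁)) :=
    eq_of_exp_comp_const (f := fun y => G (x₀, y) - Complex.log (-Γ (x₀, y)))
      ((by fun_prop : Continuous fun y => G (x₀, y)).sub
        ((by fun_prop : Continuous fun y => -Γ (x₀, y)).clog hstart)) (-1)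
      (fun y => by
        rw [Complex.exp_sub, hG', Complex.exp_log (neg_ne_zero.2 (hne _)), div_neg,
          div_self (hne _)]) _ _
  -- The sum of the four comparisons around the boundary; the two sides differ by `2πi`.
  have e : Complex.log (-Γ (x₀, y₁)) - Complex.log (-Γ (x₀, y₀)) =
      Complex.log (Γ (x₀, y₁)) - Complex.log (Γ (x₀, y₀)) := by
    linear_combination hS + hL y₁ h₁ - hL y₀ h₀ - hR
  have e' := congrArg Complex.im e
  simp only [Complex.sub_im, Complex.log_im, Complex.arg_neg_eq_arg_sub_pi_of_im_pos him₁,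
    Complex.arg_neg_eq_arg_add_pi_of_im_neg him₀] at e'
  linarith [Real.pi_pos]

/-! ### Families of filled ellipses -/

/-- If `u` and `v` are parallel over `ℝ`, the filled ellipse `p + a u + b v`, `a² + b² ≤ 1`, is
swept out by its boundary already: move `(a, b)` along the kernel of `(a, b) ↦ a u + b v` until it
reaches the unit circle. -/
theorem exists_on_circle_of_degenerate {p u v : ℂ} (hdet : u.re * v.im - u.im * v.re = 0) {a b : ℝ}
    (hab : a ^ 2 + b ^ 2 ≤ 1) :
    ∃ a' b' : ℝ, a' ^ 2 + b' ^ 2 = 1 ∧ p + a' * u + b' * v = p + a * u + b * v := by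
  obtain ⟨k, l, hkl, h⟩ : ∃ k l : ℝ, 0 < k ^ 2 + l ^ 2 ∧ (k : ℂ) * u + l * v = 0 := by
    by_cases h1 : v.im = 0 ∧ u.im = 0
    · by_cases h2 : v.re = 0 ∧ u.re = 0
      · exact ⟨1, 0, by norm_num, by
          apply Complex.ext <;> simp [h1, h2]⟩
      · refine ⟨v.re, -u.re, ?_, by apply Complex.ext <;> simp [h1]; ring⟩
        by_contra hc
        exact h2 ⟨by nlinarith [sq_nonneg v.re, sq_nonneg u.re],
          by nlinarith [sq_nonneg v.re, sq_nonneg u.re]⟩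
    · refine ⟨v.im, -u.im, ?_, by
        apply Complex.ext <;> simp
        · linarith
        · ring⟩
      by_contra hc
      exact h1 ⟨by nlinarith [sq_nonneg v.im, sq_nonneg u.im],
        by nlinarith [sq_nonneg v.im, sq_nonneg u.im]⟩
  -- The quadratic equation for `τ` says that `(a, b) + τ (k, l)` has norm `1`.
  obtain ⟨τ, hτ⟩ := exists_quadratic_eq_zero (a := k ^ 2 + l ^ 2) (b := 2 * (a * k + b * l))
    (c := a ^ 2 + b ^ 2 - 1) hkl.ne'
    ⟨√(discrim (k ^ 2 + l ^ 2) (2 * (a * k + b * l)) (a ^ 2 + b ^ 2 - 1)), by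
      rw [Real.mul_self_sqrt]
      unfold discrim
      nlinarith [sq_nonneg (a * k + b * l), mul_nonneg hkl.le (sub_nonneg.2 hab)]⟩
  refine ⟨a + τ * k, b + τ * l, by linarith, ?_⟩
  push_cast
  linear_combination (τ : ℂ) * h

/-- If the ellipses of a continuous family all avoid `0` and one of them does not enclose `0`, then
none does. The set of parameters whose filled ellipse contains `0` is closed because the disk is
compact, and open because such an ellipse is nondegenerate with `0` in its interior. -/
theorem filled_ellipse_ne_zero {X : Type*} [TopologicalSpace X] [PreconnectedSpace X]
    {p u v : X → ℂ} (hp : Continuous p) (hu : Continuous u) (hv : Continuous v)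
    (hne : ∀ x, ∀ a b : ℝ, a ^ 2 + b ^ 2 = 1 → p x + a * u x + b * v x ≠ 0) (x₀ : X)
    (h₀ : ∀ a b : ℝ, a ^ 2 + b ^ 2 ≤ 1 → p x₀ + a * u x₀ + b * v x₀ ≠ 0) (x : X) (a b : ℝ)
    (hab : a ^ 2 + b ^ 2 ≤ 1) : p x + a * u x + b * v x ≠ 0 := by
  set T : Set X := {x | ∃ a b : ℝ, a ^ 2 + b ^ 2 ≤ 1 ∧ p x + a * u x + b * v x = 0} with hT
  set D : X → ℝ := fun x => (u x).re * (v x).im - (u x).im * (v x).re with hD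
  set A : X → ℝ := fun x => (v x).re * (p x).im - (v x).im * (p x).re with hA
  set B : X → ℝ := fun x => (p x).re * (u x).im - (p x).im * (u x).re with hB
  -- By Cramer's rule, `0` is the image of `(A / D, B / D)` whenever `D ≠ 0`.
  have hTQ : T = {x | A x ^ 2 + B x ^ 2 < D x ^ 2} := by
    ext x
    constructor
    · rintro ⟨a, b, hab, h⟩
      have hlt : a ^ 2 + b ^ 2 < 1 := lt_of_le_of_ne hab fun h1 => hne x a b h1 h
      have hDx : D x ≠ 0 := fun h0 => by
        obtain ⟨a', b', h1, h2⟩ := exists_on_circle_of_degenerate (p := p x) h0 hab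
        exact hne x a' b' h1 (h2.trans h)
      have hre := congrArg Complex.re h
      have him := congrArg Complex.im h
      simp at hre him
      have e1 : A x = a * D x := by
        simp only [hA, hD]; linear_combination (v x).re * him - (v x).im * hre
      have e2 : B x = b * D x := by
        simp only [hB, hD]; linear_combination (u x).im * hre - (u x).re * him
      have : 0 < D x ^ 2 := by positivity
      simp only [Set.mem_ofPred_eq, e1, e2]
      nlinarith
    · intro h
      have h : A x ^ 2 + B x ^ 2 < D x ^ 2 := h
      have hDx : D x ≠ 0 := fun h0 => by
        rw [h0] at h; nlinarith [sq_nonneg (A x), sq_nonneg (B x)]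
      refine ⟨A x / D x, B x / D x, ?_, ?_⟩
      · rw [div_pow, div_pow, ← add_div, div_le_one (by positivity)]
        exact h.le
      · apply Complex.ext <;> simp <;> field_simp <;> simp only [hA, hB, hD] <;> ring
  have hopen : IsOpen T := by
    rw [hTQ]
    exact isOpen_lt (by fun_prop) (by fun_prop)
  have hclosed : IsClosed T := by
    let K : Set (ℝ × ℝ) := {q | q.1 ^ 2 + q.2 ^ 2 ≤ 1}
    have hK : IsCompact K := by
      refine (isCompact_Icc (a := ((-1 : ℝ), (-1 : ℝ))) (b := (1, 1))).of_isClosed_subset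
        (isClosed_le (by fun_prop) (by fun_prop)) ?_
      intro q hq
      have hq : q.1 ^ 2 + q.2 ^ 2 ≤ 1 := hq
      have h1 := abs_le.1 ((sq_le_one_iff_abs_le_one q.1).1 (by nlinarith [sq_nonneg q.2]))
      have h2 := abs_le.1 ((sq_le_one_iff_abs_le_one q.2).1 (by nlinarith [sq_nonneg q.1]))
      exact ⟨⟨h1.1, h2.1⟩, ⟨h1.2, h2.2⟩⟩
    have hc : IsClosed {q : X × K | p q.1 + (q.2 : ℝ × ℝ).1 * u q.1 + (q.2 : ℝ × ℝ).2 * v q.1 = 0} :=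
      isClosed_eq (by fun_prop) continuous_const
    have : CompactSpace K := isCompact_iff_compactSpace.1 hK
    convert isClosedMap_fst_of_compactSpace _ hc
    ext x
    constructor
    · rintro ⟨a, b, hab, h⟩
      exact ⟨(x, ⟨(a, b), hab⟩), h, rfl⟩
    · rintro ⟨⟨x', ⟨⟨a, b⟩, hab⟩⟩, h, rfl⟩
      exact ⟨a, b, hab, h⟩
  rcases isClopen_iff.1 ⟨hclosed, hopen⟩ with h | h
  · intro h0
    exact (h ▸ (⟨a, b, hab, h0⟩ : x ∈ T) : x ∈ (∅ : Set X))
  · obtain ⟨a', b', h1, h2⟩ : x₀ ∈ T := h ▸ Set.mem_univ _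
    exact (h₀ a' b' h1 h2).elim

/-- A filled ellipse that misses `0` and whose boundary misses the ray `(-∞, 0]` misses that ray:
otherwise translating it by `τ ≥ 0` would move a point of the filled ellipse, but never one of its
boundary, to `0`. -/
theorem filled_ellipse_mem_slitPlane {p u v : ℂ}
    (hne : ∀ a b : ℝ, a ^ 2 + b ^ 2 ≤ 1 → p + a * u + b * v ≠ 0)
    (hslit : ∀ a b : ℝ, a ^ 2 + b ^ 2 = 1 → p + a * u + b * v ∈ Complex.slitPlane)
    {a b : ℝ} (hab : a ^ 2 + b ^ 2 ≤ 1) : p + a * u + b * v ∈ Complex.slitPlane := by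
  by_contra hc
  simp only [Complex.mem_slitPlane_iff, not_or, not_lt, not_not] at hc
  -- `|τ|` lets the translation parameter range over a connected vector space.
  refine filled_ellipse_ne_zero (X := ℝ) (p := fun τ => p + (|τ| : ℝ)) (u := fun _ => u)
    (v := fun _ => v) (by fun_prop) (by fun_prop) (by fun_prop) (fun τ a b hab h0 => ?_) 0
    (fun a b hab => by simpa using hne a b hab) (p + a * u + b * v).re a b hab ?_
  · have := hslit a b hab
    rw [show p + a * u + b * v = ((-|τ| : ℝ) : ℂ) by push_cast; linear_combination h0,
      Complex.ofReal_mem_slitPlane] at this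
    linarith [abs_nonneg τ]
  · rw [abs_of_nonpos hc.1, show p + ((-(p + a * u + b * v).re : ℝ) : ℂ) + a * u + b * v =
      (p + a * u + b * v) - (((p + a * u + b * v).re : ℝ) : ℂ) by push_cast; ring]
    apply Complex.ext
    · simp
    · rw [Complex.sub_im, Complex.ofReal_im, hc.2]; simp

theorem affine_pos_of_pos_on_circle {p u v : ℝ}
    (h : ∀ a b : ℝ, a ^ 2 + b ^ 2 = 1 → 0 < p + a * u + b * v) {a b : ℝ}
    (hab : a ^ 2 + b ^ 2 ≤ 1) : 0 < p + a * u + b * v := by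
  have hs : √(1 - a ^ 2) ^ 2 = 1 - a ^ 2 := Real.sq_sqrt (by nlinarith [sq_nonneg b])
  have h1 := h a (√(1 - a ^ 2)) (by linarith)
  have h2 := h a (-√(1 - a ^ 2)) (by linarith [neg_sq (√(1 - a ^ 2))])
  have hb : |b| ≤ √(1 - a ^ 2) := Real.abs_le_sqrt (by linarith)
  have : |b * v| ≤ √(1 - a ^ 2) * |v| := by rw [abs_mul]; gcongr
  rcases abs_cases v with ⟨hv, _⟩ | ⟨hv, _⟩ <;> rw [hv] at this <;>
    linarith [neg_abs_le (b * v)]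

/-! ### The obstruction in the plane -/

/-- The planar form of the obstruction. The circles become moving ellipses with centres `p`, `p'` in
the closed right half-plane, and the rope a moving path `γ` from one ellipse to the other; all of
them avoid `0`. It is impossible to pass from a position where the ellipses lie in opposite
half-planes and `γ` meets the real axis only on its negative half to a position where everything
lies in the slit plane. -/
theorem no_planar_motion {p u v p' u' v' : I → ℂ} {γ : I × I → ℂ}
    (hp : Continuous p) (hu : Continuous u) (hv : Continuous v)
    (hp' : Continuous p') (hu' : Continuous u') (hv' : Continuous v') (hγ : Continuous γ)
    (hre : ∀ t, 0 ≤ (p t).re) (hre' : ∀ t, 0 ≤ (p' t).re)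
    (hne : ∀ t, ∀ a b : ℝ, a ^ 2 + b ^ 2 = 1 → p t + a * u t + b * v t ≠ 0)
    (hne' : ∀ t, ∀ a b : ℝ, a ^ 2 + b ^ 2 = 1 → p' t + a * u' t + b * v' t ≠ 0)
    (hγne : ∀ q, γ q ≠ 0)
    (hγ₀ : ∀ t, ∃ a b : ℝ, a ^ 2 + b ^ 2 = 1 ∧ γ (t, 0) = p t + a * u t + b * v t)
    (hγ₁ : ∀ t, ∃ a b : ℝ, a ^ 2 + b ^ 2 = 1 ∧ γ (t, 1) = p' t + a * u' t + b * v' t)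
    (him : ∀ a b : ℝ, a ^ 2 + b ^ 2 = 1 → (p 0 + a * u 0 + b * v 0).im < 0)
    (him' : ∀ a b : ℝ, a ^ 2 + b ^ 2 = 1 → 0 < (p' 0 + a * u' 0 + b * v' 0).im)
    (hγstart : ∀ s, -γ (0, s) ∈ Complex.slitPlane)
    (hslit : ∀ a b : ℝ, a ^ 2 + b ^ 2 = 1 → p 1 + a * u 1 + b * v 1 ∈ Complex.slitPlane)
    (hslit' : ∀ a b : ℝ, a ^ 2 + b ^ 2 = 1 → p' 1 + a * u' 1 + b * v' 1 ∈ Complex.slitPlane)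
    (hγend : ∀ s, γ (1, s) ∈ Complex.slitPlane) : False := by
  have fim (a b : ℝ) (hab : a ^ 2 + b ^ 2 ≤ 1) : (p 0 + a * u 0 + b * v 0).im < 0 := by
    have := affine_pos_of_pos_on_circle (p := -(p 0).im) (u := -(u 0).im) (v := -(v 0).im)
      (fun a b hab => by have := him a b hab; simp at this; linarith) hab
    simp; linarith
  have fim' (a b : ℝ) (hab : a ^ 2 + b ^ 2 ≤ 1) : 0 < (p' 0 + a * u' 0 + b * v' 0).im := by
    have := affine_pos_of_pos_on_circle (p := (p' 0).im) (u := (u' 0).im) (v := (v' 0).im)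
      (fun a b hab => by have := him' a b hab; simp at this; linarith) hab
    simp; linarith
  have fne := filled_ellipse_ne_zero hp hu hv hne 0
    fun a b hab h => by have := fim a b hab; simp [h] at this
  have fne' := filled_ellipse_ne_zero hp' hu' hv' hne' 0
    fun a b hab h => by have := fim' a b hab; simp [h] at this
  have center_mem {z : ℂ} (h : 0 ≤ z.re) (h0 : z ≠ 0) : z ∈ Complex.slitPlane := by
    rw [Complex.mem_slitPlane_iff]
    by_contra! hc
    exact h0 (Complex.ext (le_antisymm hc.1 h) hc.2)
  -- `Γ (t, ·)` runs on `[-1, 2]` from the centre `p t` straight to `γ (t, 0)`, along the rope, and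
  -- from `γ (t, 1)` straight to the centre `p' t`; the segments stay in the filled ellipses.
  let κ : ℝ → I := Set.projIcc 0 1 zero_le_one
  have hκ : Continuous κ := continuous_projIcc
  have hκ0 {s : ℝ} (hs : s ≤ 0) : κ s = 0 := Set.projIcc_of_le_left _ hs
  have hκ1 {s : ℝ} (hs : 1 ≤ s) : κ s = 1 := Set.projIcc_of_right_le _ hs
  let Γ : I × ℝ → ℂ := fun q => γ (q.1, κ q.2)
    + ((κ (-q.2) : ℝ) : ℂ) * (p q.1 - γ (q.1, 0))
    + ((κ (q.2 - 1) : ℝ) : ℂ) * (p' q.1 - γ (q.1, 1))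
  have hΓ : Continuous Γ := by fun_prop
  have Γ_cases (P : ℂ → Prop) (t : I) (h1 : ∀ s, P (γ (t, s)))
      (h2 : ∀ a b : ℝ, a ^ 2 + b ^ 2 ≤ 1 → P (p t + a * u t + b * v t))
      (h3 : ∀ a b : ℝ, a ^ 2 + b ^ 2 ≤ 1 → P (p' t + a * u' t + b * v' t)) (s : ℝ) :
      P (Γ (t, s)) := by
    have shrink {a b : ℝ} (hab : a ^ 2 + b ^ 2 = 1) (l : I) :
        ((1 - l) * a) ^ 2 + ((1 - l) * b) ^ 2 ≤ (1 : ℝ) := by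
      have : ((1 : ℝ) - l) ^ 2 ≤ 1 := by nlinarith [l.2.1, l.2.2]
      calc _ = ((1 : ℝ) - l) ^ 2 * (a ^ 2 + b ^ 2) := by ring
        _ ≤ 1 := by rw [hab, mul_one]; exact this
    rcases le_total s 0 with hs | hs
    · obtain ⟨a, b, hab, h⟩ := hγ₀ t
      convert h2 _ _ (shrink hab (κ (-s))) using 1
      simp only [Γ, hκ0 hs, hκ0 (show s - 1 ≤ 0 by linarith), h]
      push_cast; ring
    · rcases le_total s 1 with hs' | hs'
      · convert h1 (κ s) using 1
        simp [Γ, hκ0 (show s - 1 ≤ 0 by linarith), hκ0 (show -s ≤ 0 by linarith)]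
      · obtain ⟨a, b, hab, h⟩ := hγ₁ t
        convert h3 _ _ (shrink hab (κ (s - 1))) using 1
        simp only [Γ, hκ1 hs', hκ0 (show -s ≤ 0 by linarith), h]
        push_cast; ring
  have Γ_left (t : I) : Γ (t, -1) = p t := by
    simp [Γ, hκ0 (show (-1 : ℝ) ≤ 0 by norm_num), hκ0 (show (-1 - 1 : ℝ) ≤ 0 by norm_num),
      hκ1 (le_refl (1 : ℝ))]
  have Γ_right (t : I) : Γ (t, 2) = p' t := by
    simp [Γ, hκ0 (show (-2 : ℝ) ≤ 0 by norm_num), hκ1 (show (1 : ℝ) ≤ 2 - 1 by norm_num),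
      hκ1 (show (1 : ℝ) ≤ 2 by norm_num)]
  have : ContractibleSpace I := (convex_Icc 0 1).contractibleSpace ⟨0, by simp⟩
  have : LocallyPathConnectedSpace I := (convex_Icc 0 1).locallyPathConnectedSpace
  obtain ⟨s, hs⟩ := exists_notMem_slitPlane_of_homotopy Γ hΓ
    (fun q => Γ_cases (· ≠ 0) q.1 (fun _ => hγne _) (fne q.1) (fne' q.1) q.2) 0 1 (-1) 2
    (fun t => Γ_left t ▸ center_mem (hre t) (by simpa using fne t 0 0 (by norm_num)))
    (fun t => Γ_right t ▸ center_mem (hre' t) (by simpa using fne' t 0 0 (by norm_num)))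
    (Γ_cases (-· ∈ Complex.slitPlane) 0 hγstart
      (fun a b hab => Or.inr (by rw [Complex.neg_im]; linarith [fim a b hab]))
      (fun a b hab => Or.inr (by rw [Complex.neg_im]; linarith [fim' a b hab])))
    (by rw [Γ_left]; simpa using fim 0 0 (by norm_num))
    (by rw [Γ_right]; simpa using fim' 0 0 (by norm_num))
  exact hs (Γ_cases (· ∈ Complex.slitPlane) 1 hγend
    (fun a b => filled_ellipse_mem_slitPlane (fne 1) hslit)
    (fun a b => filled_ellipse_mem_slitPlane (fne' 1) hslit') s)

/-! ### From space to the plane -/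

/-- The unit normal `e₁ × e₂` of the plane of the placement. -/
def Placement.normal (p : Placement) : E3 :=
  WithLp.toLp 2 (crossProduct p.e₁.ofLp p.e₂.ofLp)

theorem Placement.inner_normal (p : Placement) (x : E3) :
    inner ℝ p.normal x = (p.e₁ 1 * p.e₂ 2 - p.e₁ 2 * p.e₂ 1) * x 0 +
      (p.e₁ 2 * p.e₂ 0 - p.e₁ 0 * p.e₂ 2) * x 1 + (p.e₁ 0 * p.e₂ 1 - p.e₁ 1 * p.e₂ 0) * x 2 := by
  simp [normal, cross_apply, PiLp.inner_apply, Fin.sum_univ_three]; ring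

theorem inner_eq_sum (x y : E3) : inner ℝ x y = x 0 * y 0 + x 1 * y 1 + x 2 * y 2 := by
  simp [PiLp.inner_apply, Fin.sum_univ_three]; ring

theorem Placement.inner_self₁ (p : Placement) : inner ℝ p.e₁ p.e₁ = 1 := by
  rw [real_inner_self_eq_norm_sq, p.norm_e₁, one_pow]

theorem Placement.inner_self₂ (p : Placement) : inner ℝ p.e₂ p.e₂ = 1 := by
  rw [real_inner_self_eq_norm_sq, p.norm_e₂, one_pow]

theorem Placement.orthogonal' (p : Placement) : inner ℝ p.e₂ p.e₁ = 0 := by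
  rw [real_inner_comm, p.orthogonal]

/-- The vectors `e₁`, `e₂`, `e₁ × e₂` have no common orthogonal vector other than `0`, since the
square of the triple product `⟨e₁ × e₂, y⟩` is the Gram determinant of `e₁, e₂, y`. -/
theorem Placement.eq_zero_of_orthogonal (p : Placement) {y : E3} (h₁ : inner ℝ p.e₁ y = 0)
    (h₂ : inner ℝ p.e₂ y = 0) (hn : inner ℝ p.normal y = 0) : y = 0 := by
  have h11 := p.inner_self₁
  have h22 := p.inner_self₂
  have h12 := p.orthogonal
  rw [← inner_self_eq_zero (𝕜 := ℝ)]
  have gram : inner ℝ p.normal y ^ 2 =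
      inner ℝ p.e₁ p.e₁ * (inner ℝ p.e₂ p.e₂ * inner ℝ y y - inner ℝ p.e₂ y ^ 2)
      - inner ℝ p.e₁ p.e₂ * (inner ℝ p.e₁ p.e₂ * inner ℝ y y - inner ℝ p.e₂ y * inner ℝ p.e₁ y)
      + inner ℝ p.e₁ y * (inner ℝ p.e₁ p.e₂ * inner ℝ p.e₂ y -
        inner ℝ p.e₂ p.e₂ * inner ℝ p.e₁ y) := by
    rw [p.inner_normal]; simp only [inner_eq_sum]; ring
  rw [h11, h22, h12, h₁, h₂, hn] at gram
  linarith

theorem Placement.inner_normal_e₁ (p : Placement) : inner ℝ p.normal p.e₁ = 0 := by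
  rw [p.inner_normal]; ring

theorem Placement.inner_normal_e₂ (p : Placement) : inner ℝ p.normal p.e₂ = 0 := by
  rw [p.inner_normal]; ring

theorem Placement.inner_normal_self (p : Placement) : inner ℝ p.normal p.normal = 1 := by
  have h11 := p.inner_self₁
  have h22 := p.inner_self₂
  have h12 := p.orthogonal
  have lagrange : inner ℝ p.normal p.normal =
      inner ℝ p.e₁ p.e₁ * inner ℝ p.e₂ p.e₂ - inner ℝ p.e₁ p.e₂ ^ 2 := by
    rw [p.inner_normal]; simp only [inner_eq_sum, normal, cross_apply]; simp; ring
  rw [lagrange, h11, h22, h12]; norm_num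

theorem Placement.eq_smul_normal (p : Placement) {n : E3} (h₁ : inner ℝ n p.e₁ = 0)
    (h₂ : inner ℝ n p.e₂ = 0) : ∃ k : ℝ, n = k • p.normal := by
  refine ⟨inner ℝ p.normal n, sub_eq_zero.1 (p.eq_zero_of_orthogonal ?_ ?_ ?_)⟩
  · rw [inner_sub_right, inner_smul_right, real_inner_comm, h₁, real_inner_comm p.normal,
      p.inner_normal_e₁]; ring
  · rw [inner_sub_right, inner_smul_right, real_inner_comm, h₂, real_inner_comm p.normal,
      p.inner_normal_e₂]; ring
  · rw [inner_sub_right, inner_smul_right, p.inner_normal_self]; ring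

theorem Placement.exists_eq_point (p : Placement) {x : E3}
    (h : inner ℝ p.normal (x - p.center) = 0) :
    ∃ a b : ℝ, a ^ 2 + b ^ 2 = ‖x - p.center‖ ^ 2 ∧ x = p.point a b := by
  set y := x - p.center with hy
  obtain ⟨a, b, e⟩ : ∃ a b : ℝ, y = a • p.e₁ + b • p.e₂ := by
    refine ⟨inner ℝ p.e₁ y, inner ℝ p.e₂ y, sub_eq_zero.1 (p.eq_zero_of_orthogonal ?_ ?_ ?_)⟩ <;>
      simp only [inner_sub_right, inner_add_right, inner_smul_right, p.inner_self₁,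
        p.inner_self₂, p.orthogonal, p.orthogonal', p.inner_normal_e₁, p.inner_normal_e₂, h] <;>
      ring
  refine ⟨a, b, ?_, ?_⟩
  · rw [← real_inner_self_eq_norm_sq, e]
    simp only [inner_add_left, inner_add_right, real_inner_smul_left, real_inner_smul_right,
      p.inner_self₁, p.inner_self₂, p.orthogonal, p.orthogonal']
    ring
  · rw [point, add_assoc, ← e, hy]; abel

theorem exists_cos_sin {a b ρ : ℝ} (hρ : 0 ≤ ρ) (h : a ^ 2 + b ^ 2 = ρ ^ 2) :
    ∃ θ : ℝ, a = ρ * Real.cos θ ∧ b = ρ * Real.sin θ := by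
  have hn : ‖(⟨a, b⟩ : ℂ)‖ = ρ := by
    rw [Complex.norm_eq_sqrt_sq_add_sq, h, Real.sqrt_sq hρ]
  refine ⟨Complex.arg ⟨a, b⟩, ?_, ?_⟩
  · rw [← hn, Complex.norm_mul_cos_arg]
  · rw [← hn, Complex.norm_mul_sin_arg]

theorem Placement.mem_circle_iff (p : Placement) {ρ : ℝ} {x : E3} :
    x ∈ p.circle ρ ↔ ∃ a b : ℝ, a ^ 2 + b ^ 2 = 1 ∧ x = p.point (ρ * a) (ρ * b) := by
  constructor
  · rintro ⟨θ, h⟩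
    exact ⟨_, _, Real.cos_sq_add_sin_sq θ, h⟩
  · rintro ⟨a, b, hab, h⟩
    obtain ⟨θ, rfl, rfl⟩ := exists_cos_sin zero_le_one (by rw [hab]; norm_num)
    exact ⟨θ, by simpa using h⟩

/-- The map `x ↦ (‖x - c‖² - r²) + i k ⟨n, x - c⟩`, where `c` is the centre of the hoop and `n` the
unit normal of its plane. For `k ≠ 0` its zero set is the hoop of radius `r`, and the preimage of
`(-∞, 0]` is the closed disk. The sign of `k` fixes which side of the plane is the upper one. -/
noncomputable def Placement.hoopMap (H : Placement) (r k : ℝ) (x : E3) : ℂ :=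
  ⟨‖x - H.center‖ ^ 2 - r ^ 2, k * inner ℝ H.normal (x - H.center)⟩

theorem Placement.mem_circle_of_hoopMap_eq_zero (H : Placement) {r k : ℝ} (hr : 0 ≤ r)
    (hk : k ≠ 0) {x : E3} (h : H.hoopMap r k x = 0) : x ∈ H.circle r := by
  have hre : ‖x - H.center‖ ^ 2 - r ^ 2 = 0 := congrArg Complex.re h
  have him : k * inner ℝ H.normal (x - H.center) = 0 := congrArg Complex.im h
  obtain ⟨a, b, hab, rfl⟩ := H.exists_eq_point ((mul_eq_zero.1 him).resolve_left hk)
  obtain ⟨θ, rfl, rfl⟩ := exists_cos_sin hr (by linarith : a ^ 2 + b ^ 2 = r ^ 2)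
  exact ⟨θ, rfl⟩

theorem Placement.hoopMap_mem_slitPlane (H : Placement) {r k : ℝ} (hk : k ≠ 0) {x : E3}
    (h : x ∉ H.disk r) : H.hoopMap r k x ∈ Complex.slitPlane := by
  by_contra hc
  simp only [Complex.mem_slitPlane_iff, not_or, not_lt, not_not, hoopMap] at hc
  obtain ⟨a, b, hab, hx⟩ := H.exists_eq_point ((mul_eq_zero.1 hc.2).resolve_left hk)
  exact h ⟨a, b, by linarith [hc.1], hx⟩

/-- The centre of the ellipse onto which `H.hoopMap r k` maps the circle of radius `ρ` placed at `p`.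
It is not the image of the centre of the circle: its real part has the additional term `ρ ^ 2`,
which makes it nonnegative for `r ≤ ρ`. -/
noncomputable def Placement.ellipseCenter (H p : Placement) (r k ρ : ℝ) : ℂ :=
  ⟨‖p.center - H.center‖ ^ 2 + ρ ^ 2 - r ^ 2, k * inner ℝ H.normal (p.center - H.center)⟩

/-- The conjugate semidiameter, corresponding to the frame vector `e`, of the image under
`H.hoopMap r k` of the circle of radius `ρ` placed at `p`. -/
noncomputable def Placement.ellipseAxis (H p : Placement) (k ρ : ℝ) (e : E3) : ℂ :=
  ⟨2 * ρ * inner ℝ (p.center - H.center) e, k * ρ * inner ℝ H.normal e⟩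

/-- Although the real part of `hoopMap` is quadratic, it is affine on every sphere, so that round
circles are mapped to (possibly degenerate) ellipses. -/
theorem Placement.hoopMap_point (H p : Placement) (r k ρ : ℝ) {a b : ℝ} (hab : a ^ 2 + b ^ 2 = 1) :
    H.hoopMap r k (p.point (ρ * a) (ρ * b)) = H.ellipseCenter p r k ρ +
      a * H.ellipseAxis p k ρ p.e₁ + b * H.ellipseAxis p k ρ p.e₂ := by
  have e : p.point (ρ * a) (ρ * b) - H.center =
      (p.center - H.center) + (ρ * a) • p.e₁ + (ρ * b) • p.e₂ := by rw [point]; abel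
  apply Complex.ext
  · simp only [hoopMap, ellipseCenter, ellipseAxis, e, ← real_inner_self_eq_norm_sq]
    set d := p.center - H.center
    simp [inner_add_left, inner_add_right, inner_smul_left, inner_smul_right, p.inner_self₁,
        p.inner_self₂, p.orthogonal, p.orthogonal', real_inner_comm d, -inner_self_eq_norm_sq_to_K]
    linear_combination ρ ^ 2 * hab
  · simp [hoopMap, ellipseCenter, ellipseAxis, e, inner_add_right, inner_smul_right]
    ring

theorem continuous_complex_mk {X : Type*} [TopologicalSpace X] {f g : X → ℝ} (hf : Continuous f)
    (hg : Continuous g) : Continuous fun x => (⟨f x, g x⟩ : ℂ) :=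
  Complex.equivRealProdCLM.symm.continuous.comp (hf.prodMk hg)

theorem continuous_normal {X : Type*} [TopologicalSpace X] {H : X → Placement}
    (h₁ : Continuous fun x => (H x).e₁) (h₂ : Continuous fun x => (H x).e₂) :
    Continuous fun x => (H x).normal := by
  refine (PiLp.continuous_toLp 2 _).comp (continuous_pi fun i => ?_)
  simp only [cross_apply]
  fin_cases i <;> simp <;> fun_prop

end ModelB

open ModelB

theorem mainTheorem2 (r R₁ R₂ : ℝ) (hr : 0 < r) (hR₁ : r ≤ R₁) (hR₂ : r ≤ R₂) :
    ¬ ∃ C : unitInterval → ModelB.Configuration,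
      ModelB.IsMotion r R₁ R₂ C ∧
      (C 0).IsInitial r R₁ R₂ ∧
      (C 1).HoopRemoved r R₁ R₂ := by
  rintro ⟨C, hC, ⟨n, hn, hn₁, hn₂, hA, hB, hrope⟩, hend⟩
  -- Normalizing with the given `n` at time `0` puts circle `A` below and circle `B` above.
  obtain ⟨k, rfl⟩ := (C 0).hoop.eq_smul_normal hn₁ hn₂
  have hk : k ≠ 0 := fun h => hn (by simp [h])
  obtain ⟨hHc, hH₁, hH₂⟩ := hC.continuous_hoop
  obtain ⟨hAc, hA₁, hA₂⟩ := hC.continuous_circleA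
  obtain ⟨hBc, hB₁, hB₂⟩ := hC.continuous_circleB
  have hN := continuous_normal hH₁ hH₂
  have hd : Continuous fun q : I × I => (C q.1).rope q.2 - (C q.1).hoop.center :=
    hC.continuous_rope.sub (hHc.comp continuous_fst)
  have ne (t : I) {x : E3} (hx : x ∈ (C t).piece R₁ R₂) : (C t).hoop.hoopMap r k x ≠ 0 := fun h =>
    Set.disjoint_left.1 (hC.avoids_hoop t) hx
      ((C t).hoop.mem_circle_of_hoopMap_eq_zero hr.le hk h)
  have slit {x : E3} (hx : x ∈ (C 1).piece R₁ R₂) :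
      (C 1).hoop.hoopMap r k x ∈ Complex.slitPlane :=
    (C 1).hoop.hoopMap_mem_slitPlane hk (Set.disjoint_left.1 hend hx)
  have mA (t : I) {a b : ℝ} (hab : a ^ 2 + b ^ 2 = 1) :
      (C t).circleA.point (R₁ * a) (R₁ * b) ∈ (C t).circleA.circle R₁ :=
    (Placement.mem_circle_iff _).2 ⟨a, b, hab, rfl⟩
  have mB (t : I) {a b : ℝ} (hab : a ^ 2 + b ^ 2 = 1) :
      (C t).circleB.point (R₂ * a) (R₂ * b) ∈ (C t).circleB.circle R₂ :=
    (Placement.mem_circle_iff _).2 ⟨a, b, hab, rfl⟩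
  -- The only place where the circles have to be at least as large as the hoop.
  have hcenter {ρ : ℝ} (hρ : r ≤ ρ) (H p : Placement) : 0 ≤ (H.ellipseCenter p r k ρ).re := by
    simp only [Placement.ellipseCenter]
    nlinarith [sq_nonneg ‖p.center - H.center‖]
  refine no_planar_motion
    (p := fun t => (C t).hoop.ellipseCenter (C t).circleA r k R₁)
    (u := fun t => (C t).hoop.ellipseAxis (C t).circleA k R₁ (C t).circleA.e₁)
    (v := fun t => (C t).hoop.ellipseAxis (C t).circleA k R₁ (C t).circleA.e₂)
    (p' := fun t => (C t).hoop.ellipseCenter (C t).circleB r k R₂)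
    (u' := fun t => (C t).hoop.ellipseAxis (C t).circleB k R₂ (C t).circleB.e₁)
    (v' := fun t => (C t).hoop.ellipseAxis (C t).circleB k R₂ (C t).circleB.e₂)
    (γ := fun q => (C q.1).hoop.hoopMap r k ((C q.1).rope q.2))
    (continuous_complex_mk (by fun_prop) (by fun_prop))
    (continuous_complex_mk (by fun_prop) (by fun_prop))
    (continuous_complex_mk (by fun_prop) (by fun_prop))
    (continuous_complex_mk (by fun_prop) (by fun_prop))
    (continuous_complex_mk (by fun_prop) (by fun_prop))
    (continuous_complex_mk (by fun_prop) (by fun_prop))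
    (continuous_complex_mk ((hd.norm.pow 2).sub continuous_const)
      (continuous_const.mul ((hN.comp continuous_fst).inner hd)))
    (fun t => hcenter hR₁ _ _) (fun t => hcenter hR₂ _ _)
    (fun t a b hab => ?_) (fun t a b hab => ?_) (fun q => ne _ (.inl (.inl ⟨q.2, rfl⟩)))
    (fun t => ?_) (fun t => ?_) (fun a b hab => ?_) (fun a b hab => ?_) (fun s => ?_)
    (fun a b hab => ?_) (fun a b hab => ?_) (fun s => slit (.inl (.inl ⟨s, rfl⟩)))
  · rw [← Placement.hoopMap_point _ _ _ _ _ hab]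
    exact ne t (.inl (.inr (mA t hab)))
  · rw [← Placement.hoopMap_point _ _ _ _ _ hab]
    exact ne t (.inr (mB t hab))
  · obtain ⟨a, b, hab, h⟩ := (Placement.mem_circle_iff _).1 (hC.rope_zero_mem t)
    exact ⟨a, b, hab, by rw [← Placement.hoopMap_point _ _ _ _ _ hab, h]⟩
  · obtain ⟨a, b, hab, h⟩ := (Placement.mem_circle_iff _).1 (hC.rope_one_mem t)
    exact ⟨a, b, hab, by rw [← Placement.hoopMap_point _ _ _ _ _ hab, h]⟩
  · rw [← Placement.hoopMap_point _ _ _ _ _ hab]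
    simpa only [real_inner_smul_left, Placement.hoopMap] using hA _ (mA 0 hab)
  · rw [← Placement.hoopMap_point _ _ _ _ _ hab]
    simpa only [real_inner_smul_left, Placement.hoopMap] using hB _ (mB 0 hab)
  · rw [Complex.mem_slitPlane_iff, or_iff_not_imp_right, not_not]
    intro him
    have h0 := hrope s (by rw [real_inner_smul_left]; exact neg_eq_zero.1 him)
    rw [dist_eq_norm] at h0
    simp only [Placement.hoopMap, Complex.neg_re]
    nlinarith [norm_nonneg ((C 0).rope s - (C 0).hoop.center)]
  · rw [← Placement.hoopMap_point _ _ _ _ _ hab]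
    exact slit (.inl (.inr (mA 1 hab)))
  · rw [← Placement.hoopMap_point _ _ _ _ _ hab]
    exact slit (.inr (mB 1 hab))
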